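/- Let $A$ be a finite alphabet of size $|A|=m$, and let $\boldsymbol X=\{X_n:n\ge 1\}$ be a Markov source on $A$ with initial distribution $\mu$ and irreducible transition matrix ${\bf P}=(p_{ij})$, where ${\bf P}$ is not the matrix with all entries equal to $1/m$. All logarithms are to base $2$. Let $P_n$ be the probability mass function of $X^n=(X_1,\ldots,X_n)$ and let $U^n$ be the uniform probability mass function on $A^n$. For $\epsilon\in(0,1)$, define the variable-length sample complexity of $\boldsymbol X$ by $$n^*(\boldsymbol X,\epsilon)=\inf\Big\{n\ge 1:\ \inf_{f_n,\,R>0}\max\Big\{\mathbb P\big(\ell(f_n(X^n))>nR\big),\ \frac{2^{nR}}{m^n}\Big\}\le\epsilon\Big\},$$ where the inner infimum is over all injective maps $f_n:A^n\to\{0,1\}^*$ and all real $R>0$, and $\ell(c)$ is the length of the binary string $c$. Let $D_{1/2}(p\|q)=-2\log\sum_x\sqrt{p(x)q(x)}$ and let $D_{1/2}(\boldsymbol X\|\boldsymbol U)=\lim_{n\to\infty}\frac1n D_{1/2}(P_n\|U^n)$ be the Rényi divergence rate of order $1/2$ between $\boldsymbol X$ and the i.i.d. uniform process $\boldsymbol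 U$ on $A$. Let $w=(\sqrt{\mu(a)})_{a\in A}$, and let $\lambda$ and $v$ be the Perron eigenvalue (positive and of maximal modulus) and the unit-norm, strictly positive right Perron eigenvector of the matrix with entries $\sqrt{p_{ij}/m}$; these exist. Write $\bar v=\max_i v_i$ and $\underline v=\min_i v_i$. Then the limit defining $D_{1/2}(\boldsymbol X\|\boldsymbol U)$ exists, $D_{1/2}(\boldsymbol X\|\boldsymbol U)=-2\log\lambda>0$ and, for every $\epsilon\in(0,1)$, $n^*(\boldsymbol X,\epsilon)$ is finite and $$\frac{\log(1/\epsilon)+2\log\Big(\frac{w^\intercal v}{\sqrt m\,\bar v}\Big)-4}{D_{1/2}(\boldsymbol X\|\boldsymbol U)}+1\ \le\ n^*(\boldsymbol X,\epsilon)\ \le\ \max\left\{1,\ \frac{2\log(1/\epsilon)+2\log\Big(\frac{w^\intercal v}{\sqrt m\,\underline v}\Big)}{D_{1/2}(\boldsymbol X\|\boldsymbol U)}+2\right\}.$$ -/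

import Mathlib

open MeasureTheory Filter Topology

noncomputable section

/-- `X 0, X 1, X 2, …` are the successive letters `X₁, X₂, X₃, …` of a source on the alphabet `A`;
`block X n ω` is the string `Xⁿ = (X₁, …, Xₙ)`. -/
def block {Ω A : Type*} (X : ℕ → Ω → A) (n : ℕ) (ω : Ω) : Fin n → A :=
  fun i => X i ω

/-- The probability mass function `Pₙ` of `Xⁿ` on `Aⁿ`. -/
def marginal {Ω A : Type*} [MeasurableSpace Ω] (ℙ : Measure Ω) (X : ℕ → Ω → A) (n : ℕ)
    (x : Fin n → A) : ℝ :=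
  ℙ.real {ω | block X n ω = x}

/-- The probability mass function `Uⁿ` on `Aⁿ` of the i.i.d. uniform process. -/
def uniformMarginal (A : Type*) [Fintype A] (n : ℕ) (_x : Fin n → A) : ℝ :=
  ∏ _i : Fin n, (1 / (Fintype.card A : ℝ))

/-- `X` is a (time-homogeneous) Markov chain with initial distribution `μ` and transition
matrix `P`. -/
structure IsMarkovSource {Ω A : Type*} [MeasurableSpace Ω] [MeasurableSpace A]
    (ℙ : Measure Ω) (X : ℕ → Ω → A) (μ : A → ℝ) (P : Matrix A A ℝ) : Prop where
  measurable : ∀ n, Measurable (X n)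
  initial : ∀ a, ℙ.real {ω | X 0 ω = a} = μ a
  transition : ∀ (n : ℕ) (x : ℕ → A) (b : A),
    ℙ {ω | ∀ k ≤ n, X k ω = x k} ≠ 0 →
    (ProbabilityTheory.cond ℙ {ω | ∀ k ≤ n, X k ω = x k}).real {ω | X (n + 1) ω = b} = P (x n) b

/-- Rényi divergence of order `1/2`, in bits, between two p.m.f.s on a finite set. -/
def renyiHalf {B : Type*} [Fintype B] (p q : B → ℝ) : ℝ :=
  -2 * Real.logb 2 (∑ x, √(p x * q x))

/-- The Rényi divergence rate of order `1/2` between the sources with marginals `Pₙ` and `Qₙ`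
exists and equals `D`. -/
def HasRenyiRate {A : Type*} [Fintype A] (p q : ∀ n : ℕ, (Fin n → A) → ℝ) (D : ℝ) : Prop :=
  Tendsto (fun n : ℕ => (1 / (n : ℝ)) * renyiHalf (p n) (q n)) atTop (𝓝 D)

/-- A variable-length lossless compressor for strings of length `n`. -/
def Compressor (A : Type*) (n : ℕ) : Type _ :=
  {f : (Fin n → A) → List Bool // Function.Injective f}

/-- The excess-rate probability `ℙ(ℓ(f(Xⁿ)) > nR)`. -/
def excessProb {Ω A : Type*} [MeasurableSpace Ω] (ℙ : Measure Ω) (X : ℕ → Ω → A) (n : ℕ)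
    (f : Compressor A n) (R : ℝ) : ℝ :=
  ℙ.real {ω | (n : ℝ) * R < ((f.1 (block X n ω)).length : ℝ)}

/-- `inf_{f, R > 0} max {ℙ(ℓ(f(Xⁿ)) > nR), 2^{nR} / |A|ⁿ}`, over all compressors `f` for strings
of length `n` and all rates `R > 0`. -/
def bestTradeoff {Ω A : Type*} [MeasurableSpace Ω] [Fintype A] (ℙ : Measure Ω)
    (X : ℕ → Ω → A) (n : ℕ) : ℝ :=
  ⨅ c : Compressor A n × Set.Ioi (0 : ℝ),
    max (excessProb ℙ X n c.1 c.2)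
      ((2 : ℝ) ^ ((n : ℝ) * (c.2 : ℝ)) / (Fintype.card A : ℝ) ^ n)

/-- The variable-length sample complexity `n*(X, ε)`; it is `⊤` when no blocklength works. -/
def sampleComplexity {Ω A : Type*} [MeasurableSpace Ω] [Fintype A] (ℙ : Measure Ω)
    (X : ℕ → Ω → A) (ε : ℝ) : ℕ∞ :=
  sInf ((fun n : ℕ => (n : ℕ∞)) '' {n : ℕ | 1 ≤ n ∧ bestTradeoff ℙ X n ≤ ε})

/-- The matrix `[P / m]_√` with entries `√(pᵢⱼ / m)`, where `m = |A|`. -/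
def sqrtMatrix {A : Type*} [Fintype A] (P : Matrix A A ℝ) : Matrix A A ℝ :=
  Matrix.of fun i j => √(P i j / (Fintype.card A : ℝ))

/-- `lam` is the Perron eigenvalue of `R` (a positive eigenvalue whose modulus is maximal among all
complex eigenvalues) and `v` is an associated right eigenvector with strictly positive entries and
unit Euclidean norm. -/
structure IsUnitPerronPair {A : Type*} [Fintype A] (R : Matrix A A ℝ) (lam : ℝ) (v : A → ℝ) :
    Prop where
  eigenvalue_pos : 0 < lam
  eigenvector : R.mulVec v = lam • v
  eigenvector_pos : ∀ a, 0 < v a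
  unit_norm : ‖WithLp.toLp 2 v‖ = 1
  modulus_maximal : ∀ (z : ℂ) (u : A → ℂ), u ≠ 0 →
    (R.map (fun r : ℝ => (r : ℂ))).mulVec u = z • u → ‖z‖ ≤ lam

end

/-!
The proof compares everything with the Bhattacharyya sum `Sₙ = ∑ √(Pₙ Uⁿ)`.

For a Markov source, `√(Pₙ Uⁿ)` is a product of entries of `R = √(P / m)` along the string, so
weighting the last letter by the Perron eigenvector `v` of `R` gives an exact geometric sequence
(`sum_sqrt_mul_eigenvector`). Bounding `v` by its extreme entries squeezes `Sₙ` between two multiples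
of `λⁿ⁻¹` (`le_bhattacharyya`, `bhattacharyya_le`); this yields the Rényi rate `-2 log λ`. The rate is
positive since the rows of `R` sum to at most one, with equality only for uniform rows
(`IsUnitPerronPair.lt_one`).

The smallest achievable maximum `M` of the excess-rate probability and of `2 ^ (nR) / mⁿ` satisfies
`Sₙ² / 16 ≤ M ≤ Sₙ`. For the upper bound, the strings with `Pₙ ≥ Uⁿ` receive the short codewords and
`min p q ≤ √(p q)` (`bestTradeoff_le_bhattacharyya`). For the lower bound, the strings whose codewords
have length at most `nR` number at most `2 · 2 ^ (nR)`, and the Cauchy–Schwarz inequality is applied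
to them and to the remaining strings separately (`sq_bhattacharyya_le_bestTradeoff`). Taking
logarithms in `(c λⁿ⁻¹)² ≤ 16 ε` and in `C λⁿ⁻¹ ≤ ε` gives the two bounds on the sample complexity.

The Perron eigenvalue itself is obtained as the largest Collatz–Wielandt number of `R`
(`Matrix.IsIrreducible.exists_collatzWielandt_max`).
-/

noncomputable section

/-! ### Perron–Frobenius theory of irreducible matrices -/

section Perron

variable {A : Type*} [Fintype A]

/-- An irreducible matrix commutes with an entrywise positive one, namely a sum of powers of it. -/
lemma Matrix.IsIrreducible.exists_pos_sum_pow [DecidableEq A] {R : Matrix A A ℝ} (hR : R.IsIrreducible) :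
    ∃ k : A → A → ℕ, ∀ i j, 0 < (∑ a, ∑ b, R ^ k a b) i j := by
  choose k _ hk using (Matrix.isIrreducible_iff_exists_pow_pos hR.nonneg).1 hR
  refine ⟨k, fun i j => ?_⟩
  have hnn : ∀ a b, 0 ≤ (R ^ k a b) i j := fun a b => Matrix.pow_apply_nonneg hR.nonneg _ _ _
  simp only [Matrix.sum_apply]
  calc 0 < (R ^ k i j) i j := hk i j
    _ ≤ ∑ b, (R ^ k i b) i j :=
      Finset.single_le_sum (f := fun b => (R ^ k i b) i j) (fun b _ => hnn i b) (Finset.mem_univ j)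
    _ ≤ _ := Finset.single_le_sum (f := fun a => ∑ b, (R ^ k a b) i j)
      (fun a _ => Finset.sum_nonneg fun b _ => hnn a b) (Finset.mem_univ i)

lemma Matrix.pow_mulVec_of_eigen [DecidableEq A] {R : Matrix A A ℝ} {x : A → ℝ} {r : ℝ} (h : R.mulVec x = r • x)
    (k : ℕ) : (R ^ k).mulVec x = r ^ k • x := by
  induction k with
  | zero => simp
  | succ k ih => rw [pow_succ, ← Matrix.mulVec_mulVec, h, Matrix.mulVec_smul, ih, smul_smul, pow_succ,
      mul_comm]

lemma Matrix.mulVec_pos_of_pos {T : Matrix A A ℝ} (hT : ∀ i j, 0 < T i j) {x : A → ℝ}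
    (hx : ∀ a, 0 ≤ x a) (hx0 : x ≠ 0) (i : A) : 0 < T.mulVec x i := by
  obtain ⟨j, hj⟩ := Function.ne_iff.1 hx0
  exact Finset.sum_pos' (fun a _ => mul_nonneg (hT i a).le (hx a))
    ⟨j, Finset.mem_univ j, mul_pos (hT i j) (lt_of_le_of_ne (hx j) (Ne.symm hj))⟩

/-- The Collatz–Wielandt set: pairs `(r, x)` with `x` a probability vector and `r x ≤ R x`. -/
def collatzWielandtSet (R : Matrix A A ℝ) : Set (ℝ × (A → ℝ)) :=
  {p | 0 ≤ p.1 ∧ p.2 ∈ stdSimplex ℝ A ∧ ∀ a, p.1 * p.2 a ≤ R.mulVec p.2 a}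

lemma isCompact_collatzWielandtSet {R : Matrix A A ℝ} (hR : ∀ i j, 0 ≤ R i j) :
    IsCompact (collatzWielandtSet R) := by
  have hK : IsCompact (Set.Icc (0 : ℝ) (∑ i, ∑ j, R i j) ×ˢ stdSimplex ℝ A) :=
    isCompact_Icc.prod (isCompact_stdSimplex ℝ A)
  refine hK.of_isClosed_subset ?_ ?_
  · have h1 : IsClosed {p : ℝ × (A → ℝ) | 0 ≤ p.1} := isClosed_le continuous_const continuous_fst
    have h2 : IsClosed {p : ℝ × (A → ℝ) | p.2 ∈ stdSimplex ℝ A} :=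
      (isClosed_stdSimplex ℝ A).preimage continuous_snd
    have h3 : IsClosed {p : ℝ × (A → ℝ) | ∀ a, p.1 * p.2 a ≤ R.mulVec p.2 a} := by
      simp only [Set.ofPred_forall]
      refine isClosed_iInter fun a => isClosed_le (by fun_prop) ?_
      simp only [Matrix.mulVec, dotProduct]
      fun_prop
    exact h1.inter (h2.inter h3)
  · rintro ⟨r, x⟩ ⟨hr, hx, h⟩
    refine ⟨⟨hr, ?_⟩, hx⟩
    have hx1 : ∀ a, x a ≤ 1 := fun a => by
      rw [← hx.2]
      exact Finset.single_le_sum (fun b _ => hx.1 b) (Finset.mem_univ a)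
    calc r = ∑ a, r * x a := by rw [← Finset.mul_sum, hx.2, mul_one]
      _ ≤ ∑ a, R.mulVec x a := Finset.sum_le_sum fun a _ => h a
      _ ≤ _ := Finset.sum_le_sum fun i _ => Finset.sum_le_sum fun j _ =>
        mul_le_of_le_one_right (hR i j) (hx1 j)

lemma normalize_mem_collatzWielandtSet {R : Matrix A A ℝ} {r : ℝ} {u : A → ℝ}
    (hr : 0 ≤ r) (hu : ∀ a, 0 ≤ u a) (hu0 : u ≠ 0) (h : ∀ a, r * u a ≤ R.mulVec u a) :
    (r, (∑ a, u a)⁻¹ • u) ∈ collatzWielandtSet R := by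
  have hs : 0 < ∑ a, u a := by
    obtain ⟨j, hj⟩ := Function.ne_iff.1 hu0
    exact Finset.sum_pos' (fun a _ => hu a)
      ⟨j, Finset.mem_univ j, lt_of_le_of_ne (hu j) (Ne.symm hj)⟩
  refine ⟨hr, ⟨fun a => ?_, ?_⟩, fun a => ?_⟩
  · exact mul_nonneg (inv_nonneg.2 hs.le) (hu a)
  · simp only [Pi.smul_apply, smul_eq_mul, ← Finset.mul_sum]
    exact inv_mul_cancel₀ hs.ne'
  · rw [Matrix.mulVec_smul]
    simp only [Pi.smul_apply, smul_eq_mul]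
    calc r * ((∑ a, u a)⁻¹ * u a) = (∑ a, u a)⁻¹ * (r * u a) := by ring
      _ ≤ _ := mul_le_mul_of_nonneg_left (h a) (inv_nonneg.2 hs.le)

/-- **Perron–Frobenius.** The maximal Collatz–Wielandt number `r` of an irreducible matrix is an
eigenvalue with a positive eigenvector. -/
theorem Matrix.IsIrreducible.exists_collatzWielandt_max [DecidableEq A] [Nonempty A] {R : Matrix A A ℝ}
    (hR : R.IsIrreducible) :
    ∃ (r : ℝ) (x : A → ℝ), 0 ≤ r ∧ (∀ a, 0 < x a) ∧ R.mulVec x = r • x ∧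
      ∀ (s : ℝ) (u : A → ℝ), 0 ≤ s → (∀ a, 0 ≤ u a) → u ≠ 0 →
        (∀ a, s * u a ≤ R.mulVec u a) → s ≤ r := by
  obtain ⟨a₀⟩ := ‹Nonempty A›
  have hne : (collatzWielandtSet R).Nonempty :=
    ⟨_, normalize_mem_collatzWielandtSet (r := 0) (u := fun _ => 1) le_rfl
      (fun _ => zero_le_one) (fun h => one_ne_zero (congrFun h a₀)) fun a => by
        simpa [Matrix.mulVec, dotProduct] using Finset.sum_nonneg fun j _ => hR.nonneg a j⟩
  obtain ⟨⟨r, x⟩, ⟨hr, hx, hle⟩, hmax⟩ :=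
    (isCompact_collatzWielandtSet hR.nonneg).exists_isMaxOn hne continuous_fst.continuousOn
  have hbest : ∀ (s : ℝ) (u : A → ℝ), 0 ≤ s → (∀ a, 0 ≤ u a) → u ≠ 0 →
      (∀ a, s * u a ≤ R.mulVec u a) → s ≤ r := fun s u hs hu hu0 h =>
    hmax (normalize_mem_collatzWielandtSet hs hu hu0 h)
  have hx0 : x ≠ 0 := by
    rintro rfl
    simpa using hx.2
  obtain ⟨k, hk⟩ := hR.exists_pos_sum_pow
  set T : Matrix A A ℝ := ∑ a, ∑ b, R ^ k a b with hT
  have hcomm : R * T = T * R :=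
    (Commute.sum_right _ _ _ fun a _ => Commute.sum_right _ _ _ fun b _ =>
      (Commute.refl R).pow_right _)
  have hTx : ∀ a, 0 < T.mulVec x a := Matrix.mulVec_pos_of_pos hk hx.1 hx0
  have heig : R.mulVec x = r • x := by
    by_contra hcon
    -- Otherwise `T x` satisfies `r (T x) < R (T x)` in every coordinate, so `r` can be increased.
    have hpos : ∀ a, 0 < T.mulVec (R.mulVec x - r • x) a :=
      Matrix.mulVec_pos_of_pos hk (fun a => sub_nonneg.2 (hle a)) (sub_ne_zero.2 hcon)
    have hlt : ∀ a, r * T.mulVec x a < R.mulVec (T.mulVec x) a := fun a => by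
      have := hpos a
      rw [Matrix.mulVec_sub, Matrix.mulVec_mulVec, ← hcomm, ← Matrix.mulVec_mulVec,
        Matrix.mulVec_smul] at this
      simpa using this
    obtain ⟨b, hb⟩ := Finite.exists_min fun a => R.mulVec (T.mulVec x) a / T.mulVec x a
    have hrb : r < R.mulVec (T.mulVec x) b / T.mulVec x b := (lt_div_iff₀ (hTx b)).2 (hlt b)
    exact absurd (hbest _ (T.mulVec x) (hr.trans hrb.le) (fun a => (hTx a).le)
      (fun h => (hTx a₀).ne' (congrFun h a₀)) fun a => (le_div_iff₀ (hTx a)).1 (hb a)) hrb.not_ge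
  refine ⟨r, x, hr, fun a => ?_, heig, hbest⟩
  have hTx' : T.mulVec x = (∑ a, ∑ b, r ^ k a b) • x := by
    simp only [hT, Matrix.sum_mulVec, Matrix.pow_mulVec_of_eigen heig, Finset.sum_smul]
  have := hTx a
  rw [hTx'] at this
  exact pos_of_mul_pos_right this (by positivity)

/-- An irreducible matrix without zero rows has a unit Perron pair. The row hypothesis only excludes
the `1 × 1` zero matrix. -/
theorem Matrix.IsIrreducible.exists_isUnitPerronPair [DecidableEq A] [Nonempty A] {R : Matrix A A ℝ}
    (hR : R.IsIrreducible) (hrow : ∀ i, ∃ j, 0 < R i j) :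
    ∃ (lam : ℝ) (v : A → ℝ), IsUnitPerronPair R lam v := by
  obtain ⟨r, x, hr, hx, heig, hbest⟩ := hR.exists_collatzWielandt_max
  obtain ⟨a₀⟩ := ‹Nonempty A›
  have hx0 : 0 < ‖WithLp.toLp 2 x‖ := by
    rw [norm_pos_iff]
    intro h
    exact (hx a₀).ne' (congrArg (fun y : EuclideanSpace ℝ A => y a₀) h)
  refine ⟨r, ‖WithLp.toLp 2 x‖⁻¹ • x, ?_, ?_, fun a => ?_, ?_, fun z u hu hzu => ?_⟩
  · obtain ⟨j, hj⟩ := hrow a₀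
    have h1 : 0 < R.mulVec x a₀ := Finset.sum_pos' (fun a _ => mul_nonneg (hR.nonneg _ _) (hx a).le)
      ⟨j, Finset.mem_univ j, mul_pos hj (hx j)⟩
    rw [heig] at h1
    exact pos_of_mul_pos_left h1 (hx a₀).le
  · rw [Matrix.mulVec_smul, heig, smul_comm]
  · exact mul_pos (inv_pos.2 hx0) (hx a)
  · rw [WithLp.toLp_smul, norm_smul, norm_inv, norm_norm, inv_mul_cancel₀ hx0.ne']
  · refine hbest ‖z‖ (fun a => ‖u a‖) (norm_nonneg z) (fun a => norm_nonneg _) (fun h => hu ?_) ?_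
    · funext a
      exact norm_eq_zero.1 (congrFun h a)
    · intro a
      have h := congrFun hzu a
      rw [← norm_mul, ← smul_eq_mul, ← Pi.smul_apply, ← h]
      refine (norm_sum_le _ _).trans (Finset.sum_le_sum fun j _ => ?_)
      simp [abs_of_nonneg (hR.nonneg a j)]

end Perron

/-! ### The matrix of square roots -/

section SqrtMatrix

variable {A : Type*} [Fintype A]

lemma sqrtMatrix_nonneg (P : Matrix A A ℝ) (i j : A) : 0 ≤ sqrtMatrix P i j := Real.sqrt_nonneg _

lemma sqrtMatrix_pos [Nonempty A] {P : Matrix A A ℝ} {i j : A} (h : 0 < P i j) :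
    0 < sqrtMatrix P i j :=
  Real.sqrt_pos.2 (div_pos h (by exact_mod_cast Fintype.card_pos))

lemma Matrix.IsIrreducible.sqrtMatrix [DecidableEq A] [Nonempty A] {P : Matrix A A ℝ} (hP : P.IsIrreducible) :
    (sqrtMatrix P).IsIrreducible := by
  rw [Matrix.isIrreducible_iff_exists_pow_pos (sqrtMatrix_nonneg P)]
  intro i j
  obtain ⟨k, hk, hpos⟩ := (Matrix.isIrreducible_iff_exists_pow_pos hP.nonneg).1 hP i j
  refine ⟨k, hk, ?_⟩
  clear hk
  induction k generalizing j with
  | zero => simpa using hpos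
  | succ k ih =>
    rw [pow_succ, Matrix.mul_apply] at hpos ⊢
    obtain ⟨l, -, hl⟩ := (Finset.sum_pos_iff_of_nonneg fun l _ =>
      mul_nonneg (Matrix.pow_apply_nonneg hP.nonneg k i l) (hP.nonneg l j)).1 hpos
    refine Finset.sum_pos' (fun l _ => mul_nonneg
      (Matrix.pow_apply_nonneg (sqrtMatrix_nonneg P) k i l) (sqrtMatrix_nonneg P l j))
      ⟨l, Finset.mem_univ l, mul_pos (ih l ?_) (sqrtMatrix_pos ?_)⟩
    · exact pos_of_mul_pos_left hl (hP.nonneg l j)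
    · exact pos_of_mul_pos_right hl (Matrix.pow_apply_nonneg hP.nonneg k i l)

/-- The arithmetic–geometric mean inequality with its deficit made explicit; summed over a row, it
gives `∑ j, √(P i j / m) ≤ 1` together with the case of equality. -/
lemma sqrtMatrix_apply_eq [Nonempty A] {P : Matrix A A ℝ} (hP : ∀ i j, 0 ≤ P i j) (i j : A) :
    sqrtMatrix P i j = (P i j + 1 / (Fintype.card A : ℝ)) / 2
      - (√(P i j) - √(1 / (Fintype.card A : ℝ))) ^ 2 / 2 := by
  have h : sqrtMatrix P i j = √(P i j) * √(1 / (Fintype.card A : ℝ)) := by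
    rw [← Real.sqrt_mul (hP i j), mul_one_div]
    rfl
  rw [h, sub_sq, Real.sq_sqrt (hP i j), Real.sq_sqrt (by positivity)]
  ring

lemma sum_sqrtMatrix_eq [DecidableEq A] [Nonempty A] {P : Matrix A A ℝ} (hP : P ∈ Matrix.rowStochastic ℝ A) (i : A) :
    ∑ j, sqrtMatrix P i j = 1 - (∑ j, (√(P i j) - √(1 / (Fintype.card A : ℝ))) ^ 2) / 2 := by
  have hm : (Fintype.card A : ℝ) ≠ 0 := by exact_mod_cast Fintype.card_ne_zero
  simp only [sqrtMatrix_apply_eq (fun i j => Matrix.nonneg_of_mem_rowStochastic hP),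
    Finset.sum_sub_distrib, ← Finset.sum_div, Finset.sum_add_distrib,
    Matrix.sum_row_of_mem_rowStochastic hP]
  simp [hm]

lemma sum_sqrtMatrix_le_one [DecidableEq A] [Nonempty A] {P : Matrix A A ℝ} (hP : P ∈ Matrix.rowStochastic ℝ A)
    (i : A) : ∑ j, sqrtMatrix P i j ≤ 1 := by
  rw [sum_sqrtMatrix_eq hP]
  have : 0 ≤ ∑ j, (√(P i j) - √(1 / (Fintype.card A : ℝ))) ^ 2 :=
    Finset.sum_nonneg fun j _ => sq_nonneg _
  linarith

lemma eq_uniform_of_one_le_sum_sqrtMatrix [DecidableEq A] [Nonempty A] {P : Matrix A A ℝ}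
    (hP : P ∈ Matrix.rowStochastic ℝ A) {i : A} (h : 1 ≤ ∑ j, sqrtMatrix P i j) (j : A) :
    P i j = 1 / (Fintype.card A : ℝ) := by
  rw [sum_sqrtMatrix_eq hP] at h
  have h0 : ∑ j, (√(P i j) - √(1 / (Fintype.card A : ℝ))) ^ 2 = 0 :=
    le_antisymm (by linarith) (Finset.sum_nonneg fun j _ => sq_nonneg _)
  have hj := (Finset.sum_eq_zero_iff_of_nonneg fun j _ => sq_nonneg _).1 h0 j (Finset.mem_univ j)
  exact (Real.sqrt_inj (Matrix.nonneg_of_mem_rowStochastic hP) (by positivity)).1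
    (sub_eq_zero.1 (pow_eq_zero_iff two_ne_zero |>.1 hj))

/-- Unless all transition probabilities are equal, the Perron eigenvalue is less than one: at a
largest coordinate of `v`, an eigenvalue `≥ 1` makes the row uniform, which forces `v` to be
constant and then every row to be uniform. -/
lemma IsUnitPerronPair.lt_one [DecidableEq A] [Nonempty A] {P : Matrix A A ℝ} (hP : P ∈ Matrix.rowStochastic ℝ A)
    (hne : ∃ i j, P i j ≠ 1 / (Fintype.card A : ℝ)) {lam : ℝ} {v : A → ℝ}
    (h : IsUnitPerronPair (sqrtMatrix P) lam v) : lam < 1 := by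
  by_contra! hlam
  have hR := sqrtMatrix_nonneg P
  have hv : ∀ i, ∑ j, sqrtMatrix P i j * v j = lam * v i := fun i => congrFun h.eigenvector i
  obtain ⟨i, hi⟩ := Finite.exists_max v
  have hle : ∀ k, ∑ j, sqrtMatrix P k j * v j ≤ (∑ j, sqrtMatrix P k j) * v i := fun k => by
    rw [Finset.sum_mul]
    exact Finset.sum_le_sum fun j _ => mul_le_mul_of_nonneg_left (hi j) (hR k j)
  -- A row at which `v` is maximal has full weight, hence is uniform.
  have hrow : ∀ k, v k = v i → 1 ≤ ∑ j, sqrtMatrix P k j := fun k hk => by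
    have := (hv k).symm.trans_le (hle k)
    rw [hk] at this
    exact hlam.trans (le_of_mul_le_mul_right this (h.eigenvector_pos i))
  have hPi := eq_uniform_of_one_le_sum_sqrtMatrix hP (hrow i rfl)
  have hconst : ∀ j, v j = v i := by
    have hsum : ∑ j, sqrtMatrix P i j * (v i - v j) ≤ 0 := by
      simp only [mul_sub, Finset.sum_sub_distrib, hv, ← Finset.sum_mul]
      have h1 := mul_le_mul_of_nonneg_right (sum_sqrtMatrix_le_one hP i) (h.eigenvector_pos i).le
      have h2 := mul_le_mul_of_nonneg_right hlam (h.eigenvector_pos i).le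
      linarith
    have hnn : ∀ j ∈ Finset.univ, 0 ≤ sqrtMatrix P i j * (v i - v j) := fun j _ =>
      mul_nonneg (hR i j) (sub_nonneg.2 (hi j))
    intro j
    have hj := (Finset.sum_eq_zero_iff_of_nonneg hnn).1
      (le_antisymm hsum (Finset.sum_nonneg hnn)) j (Finset.mem_univ j)
    have hpos : 0 < sqrtMatrix P i j := sqrtMatrix_pos (by
      rw [hPi j]
      exact one_div_pos.2 (by exact_mod_cast Fintype.card_pos))
    exact (sub_eq_zero.1 ((mul_eq_zero.1 hj).resolve_left hpos.ne')).symm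
  obtain ⟨a, b, hab⟩ := hne
  exact hab (eq_uniform_of_one_le_sum_sqrtMatrix hP (hrow a (hconst a)) b)

end SqrtMatrix

/-! ### The Bhattacharyya sum of a Markov source and the uniform source -/

section Markov

variable {Ω A : Type*} [MeasurableSpace Ω]

/-- The Bhattacharyya coefficient `∑ √(Pₙ Uⁿ)` of the law of `Xⁿ` and the uniform law. -/
def bhattacharyya [Fintype A] (ℙ : Measure Ω) (X : ℕ → Ω → A) (n : ℕ) : ℝ :=
  ∑ x : Fin n → A, √(marginal ℙ X n x * uniformMarginal A n x)

lemma marginal_nonneg (ℙ : Measure Ω) (X : ℕ → Ω → A) (n : ℕ) (x : Fin n → A) :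
    0 ≤ marginal ℙ X n x := measureReal_nonneg

lemma uniformMarginal_eq [Fintype A] (n : ℕ) (x : Fin n → A) :
    uniformMarginal A n x = 1 / (Fintype.card A : ℝ) ^ n := by
  simp [uniformMarginal]

lemma uniformMarginal_nonneg [Fintype A] (n : ℕ) (x : Fin n → A) : 0 ≤ uniformMarginal A n x := by
  rw [uniformMarginal_eq]
  positivity

lemma measurableSet_block_eq [MeasurableSpace A] [MeasurableSingletonClass A] {X : ℕ → Ω → A}
    (hX : ∀ n, Measurable (X n)) (n : ℕ) (x : Fin n → A) :
    MeasurableSet {ω | block X n ω = x} := by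
  simp only [funext_iff, block, Set.ofPred_forall]
  exact MeasurableSet.iInter fun i => hX i (measurableSet_singleton (x i))

lemma sum_uniformMarginal_eq [Fintype A] (n : ℕ) (T : Finset (Fin n → A)) :
    ∑ x ∈ T, uniformMarginal A n x = T.card / (Fintype.card A : ℝ) ^ n := by
  simp only [uniformMarginal_eq, Finset.sum_const, nsmul_eq_mul, mul_one_div]

lemma sum_sqrt_le_bhattacharyya [Fintype A] (ℙ : Measure Ω) (X : ℕ → Ω → A) (n : ℕ)
    (T : Finset (Fin n → A)) :
    ∑ x ∈ T, √(marginal ℙ X n x * uniformMarginal A n x) ≤ bhattacharyya ℙ X n :=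
  Finset.sum_le_sum_of_subset_of_nonneg (Finset.subset_univ T) fun _ _ _ => Real.sqrt_nonneg _

variable [MeasurableSpace A] {ℙ : Measure Ω} {X : ℕ → Ω → A} {μ : A → ℝ} {P : Matrix A A ℝ}

lemma marginal_one (hX : IsMarkovSource ℙ X μ P) (x : Fin 1 → A) :
    marginal ℙ X 1 x = μ (x 0) := by
  rw [← hX.initial, marginal]
  congr 1
  ext ω
  simp [block, funext_iff]

lemma marginal_snoc [MeasurableSingletonClass A] [IsProbabilityMeasure ℙ]
    (hX : IsMarkovSource ℙ X μ P) (n : ℕ) (x : Fin (n + 1) → A) (b : A) :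
    marginal ℙ X (n + 2) (Fin.snoc (α := fun _ => A) x b)
      = marginal ℙ X (n + 1) x * P (x (Fin.last n)) b := by
  set y : ℕ → A := fun k => x ⟨min k n, by omega⟩ with hy
  have hyn : y n = x (Fin.last n) := congrArg x (Fin.ext (min_self n))
  have hE : {ω | block X (n + 1) ω = x} = {ω | ∀ k ≤ n, X k ω = y k} := by
    ext ω
    simp only [Set.mem_ofPred_eq, funext_iff, block, hy]
    constructor
    · intro h k hk
      have := h ⟨k, by omega⟩
      simpa [min_eq_left hk] using this
    · intro h k
      have := h k (by omega)
      simpa [min_eq_left (show (k : ℕ) ≤ n by omega)] using this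
  have hEm : MeasurableSet {ω | ∀ k ≤ n, X k ω = y k} := by
    simp only [Set.ofPred_forall]
    exact MeasurableSet.iInter fun k => MeasurableSet.iInter fun _ =>
      hX.measurable k (measurableSet_singleton (y k))
  have hinter : {ω | block X (n + 2) ω = (Fin.snoc (α := fun _ => A) x b : Fin (n + 2) → A)}
      = {ω | ∀ k ≤ n, X k ω = y k} ∩ {ω | X (n + 1) ω = b} := by
    rw [← hE]
    ext ω
    simp only [Set.mem_ofPred_eq, Set.mem_inter_iff, funext_iff, Fin.forall_fin_succ' (n := n + 1),
      Fin.snoc_castSucc, Fin.snoc_last, block, Fin.val_castSucc, Fin.val_last]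
  rw [marginal, marginal, hinter, hE]
  by_cases h0 : ℙ {ω | ∀ k ≤ n, X k ω = y k} = 0
  · rw [measureReal_def, measureReal_def, h0, measure_mono_null Set.inter_subset_left h0]
    simp
  · have h := hX.transition n y b h0
    rw [← hyn, ← h, mul_comm, measureReal_def, measureReal_def, measureReal_def,
      ← ENNReal.toReal_mul, ProbabilityTheory.cond_mul_eq_inter hEm]

/-- Weighting the last letter by a right eigenvector of `√(P / m)` turns the Bhattacharyya sum into
an exact geometric sequence. -/
lemma sum_sqrt_mul_eigenvector [Fintype A] [MeasurableSingletonClass A]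
    [IsProbabilityMeasure ℙ] (hX : IsMarkovSource ℙ X μ P) {lam : ℝ} {v : A → ℝ}
    (hv : (sqrtMatrix P).mulVec v = lam • v) (n : ℕ) :
    ∑ x : Fin (n + 1) → A, √(marginal ℙ X (n + 1) x * uniformMarginal A (n + 1) x)
        * v (x (Fin.last n))
      = (∑ a, √(μ a) * v a) / √(Fintype.card A : ℝ) * lam ^ n := by
  induction n with
  | zero =>
    rw [← (Equiv.funUnique (Fin 1) A).symm.sum_comp, pow_zero, mul_one, Finset.sum_div]
    refine Finset.sum_congr rfl fun a _ => ?_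
    rw [marginal_one hX, uniformMarginal_eq]
    simp [Real.sqrt_mul', div_eq_mul_inv]
    ring
  | succ n ih =>
    rw [← (Fin.snocEquiv (fun _ : Fin (n + 2) => A)).sum_comp, Fintype.sum_prod_type_right]
    have key : ∀ (x : Fin (n + 1) → A) (b : A),
        √(marginal ℙ X (n + 2) (Fin.snoc (α := fun _ => A) x b)
          * uniformMarginal A (n + 2) (Fin.snoc (α := fun _ => A) x b))
        = √(marginal ℙ X (n + 1) x * uniformMarginal A (n + 1) x)
          * sqrtMatrix P (x (Fin.last n)) b := fun x b => by
      rw [marginal_snoc hX, uniformMarginal_eq, uniformMarginal_eq, sqrtMatrix, Matrix.of_apply,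
        ← Real.sqrt_mul (by have := marginal_nonneg ℙ X (n + 1) x; positivity)]
      congr 1
      rw [pow_succ]
      simp only [div_eq_mul_inv, mul_inv]
      ring
    calc _ = ∑ x : Fin (n + 1) → A, √(marginal ℙ X (n + 1) x * uniformMarginal A (n + 1) x)
          * ∑ b, sqrtMatrix P (x (Fin.last n)) b * v b := by
          refine Finset.sum_congr rfl fun x _ => ?_
          rw [Finset.mul_sum]
          refine Finset.sum_congr rfl fun b _ => ?_
          rw [← mul_assoc]
          exact congrArg₂ (· * ·) (key x b) (congrArg v (Fin.snoc_last (α := fun _ => A) b x))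
      _ = ∑ x : Fin (n + 1) → A, √(marginal ℙ X (n + 1) x * uniformMarginal A (n + 1) x)
          * v (x (Fin.last n)) * lam := by
          refine Finset.sum_congr rfl fun x _ => ?_
          have h := congrFun hv (x (Fin.last n))
          simp only [Matrix.mulVec, dotProduct, Pi.smul_apply, smul_eq_mul] at h
          rw [h]
          ring
      _ = _ := by rw [← Finset.sum_mul, ih, pow_succ, mul_assoc]

section Sandwich

variable [Fintype A] [Nonempty A] [MeasurableSingletonClass A] [IsProbabilityMeasure ℙ]

lemma bhattacharyya_le (hX : IsMarkovSource ℙ X μ P) {lam : ℝ} {v : A → ℝ}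
    (h : IsUnitPerronPair (sqrtMatrix P) lam v) (n : ℕ) :
    bhattacharyya ℙ X (n + 1)
      ≤ (∑ a, √(μ a) * v a) / (√(Fintype.card A : ℝ) * ⨅ a, v a) * lam ^ n := by
  obtain ⟨i, hi⟩ := exists_eq_ciInf_of_finite (f := v)
  have hpos : 0 < ⨅ a, v a := hi ▸ h.eigenvector_pos i
  rw [← div_div, div_mul_eq_mul_div, le_div_iff₀ hpos, ← sum_sqrt_mul_eigenvector hX h.eigenvector,
    bhattacharyya, Finset.sum_mul]
  exact Finset.sum_le_sum fun x _ => mul_le_mul_of_nonneg_left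
    (ciInf_le (Set.finite_range v).bddBelow _) (Real.sqrt_nonneg _)

lemma le_bhattacharyya (hX : IsMarkovSource ℙ X μ P) {lam : ℝ} {v : A → ℝ}
    (h : IsUnitPerronPair (sqrtMatrix P) lam v) (n : ℕ) :
    (∑ a, √(μ a) * v a) / (√(Fintype.card A : ℝ) * ⨆ a, v a) * lam ^ n
      ≤ bhattacharyya ℙ X (n + 1) := by
  obtain ⟨i, hi⟩ := exists_eq_ciSup_of_finite (f := v)
  have hpos : 0 < ⨆ a, v a := hi ▸ h.eigenvector_pos i
  rw [← div_div, div_mul_eq_mul_div, div_le_iff₀ hpos, ← sum_sqrt_mul_eigenvector hX h.eigenvector,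
    bhattacharyya, Finset.sum_mul]
  exact Finset.sum_le_sum fun x _ => mul_le_mul_of_nonneg_left
    (le_ciSup (Set.finite_range v).bddAbove _) (Real.sqrt_nonneg _)

end Sandwich

end Markov

/-- `wᵀ v > 0` for a probability vector `μ`, with `w = √μ`, and a positive vector `v`. -/
lemma sum_sqrt_mul_pos {A : Type*} [Fintype A] {μ v : A → ℝ} (hμ : μ ∈ stdSimplex ℝ A)
    (hv : ∀ a, 0 < v a) : 0 < ∑ a, √(μ a) * v a := by
  obtain ⟨a, -, ha⟩ : ∃ a ∈ Finset.univ, 0 < μ a :=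
    Finset.exists_lt_of_sum_lt (f := fun _ => (0 : ℝ)) (by simp [hμ.2])
  exact Finset.sum_pos' (fun b _ => mul_nonneg (Real.sqrt_nonneg _) (hv b).le)
    ⟨a, Finset.mem_univ a, mul_pos (Real.sqrt_pos.2 ha) (hv a)⟩

/-- A sequence squeezed between two positive multiples of `rⁿ` has exponential growth rate
`log₂ r`. -/
lemma tendsto_logb_div_of_geometric {s : ℕ → ℝ} {c C r : ℝ} (hc : 0 < c) (hC : 0 < C) (hr : 0 < r)
    (hl : ∀ n, c * r ^ n ≤ s (n + 1)) (hu : ∀ n, s (n + 1) ≤ C * r ^ n) :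
    Tendsto (fun n : ℕ => Real.logb 2 (s n) / n) atTop (𝓝 (Real.logb 2 r)) := by
  rw [← tendsto_add_atTop_iff_nat 1]
  have hlim : ∀ k : ℝ, Tendsto (fun n : ℕ => (k + n * Real.logb 2 r) / ((n + 1 : ℕ) : ℝ)) atTop
      (𝓝 (Real.logb 2 r)) := fun k => by
    have h1 : Tendsto (fun n : ℕ => 1 / ((n : ℝ) + 1)) atTop (𝓝 0) :=
      tendsto_one_div_add_atTop_nhds_zero_nat
    have h2 := (h1.const_mul (k - Real.logb 2 r)).add_const (Real.logb 2 r)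
    rw [mul_zero, zero_add] at h2
    refine h2.congr fun n => ?_
    have : (n : ℝ) + 1 ≠ 0 := by positivity
    push_cast
    field_simp
    ring
  have hlog : ∀ (k : ℝ) (n : ℕ), 0 < k →
      Real.logb 2 (k * r ^ n) = Real.logb 2 k + n * Real.logb 2 r := fun k n hk => by
    rw [Real.logb_mul hk.ne' (pow_pos hr n).ne', Real.logb_pow]
  refine tendsto_of_tendsto_of_tendsto_of_le_of_le (hlim (Real.logb 2 c)) (hlim (Real.logb 2 C))
    (fun n => ?_) (fun n => ?_)
  · dsimp only
    rw [← hlog c n hc]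
    exact div_le_div_of_nonneg_right
      (Real.logb_le_logb_of_le one_lt_two (mul_pos hc (pow_pos hr n)) (hl n)) (by positivity)
  · dsimp only
    rw [← hlog C n hC]
    exact div_le_div_of_nonneg_right (Real.logb_le_logb_of_le one_lt_two
      ((mul_pos hc (pow_pos hr n)).trans_le (hl n)) (hu n)) (by positivity)

/-! ### Counting binary strings -/

/-- The binary strings of length at most `L`. -/
def shortStrings (L : ℕ) : Finset (List Bool) :=
  ((Finset.range (L + 1)).sigma fun k => (Finset.univ : Finset (Fin k → Bool))).map
    List.equivSigmaTuple.symm.toEmbedding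

lemma mem_shortStrings {L : ℕ} {l : List Bool} : l ∈ shortStrings L ↔ l.length ≤ L := by
  rw [shortStrings, Finset.mem_map_equiv, Equiv.symm_symm]
  simp [List.equivSigmaTuple]

lemma card_shortStrings_add_one (L : ℕ) : (shortStrings L).card + 1 = 2 ^ (L + 1) := by
  rw [shortStrings, Finset.card_map, Finset.card_sigma]
  simp only [Finset.card_univ, Fintype.card_fun, Fintype.card_bool, Fintype.card_fin]
  induction L with
  | zero => simp
  | succ L ih =>
    rw [Finset.sum_range_succ, pow_succ 2 (L + 1), ← ih]
    omega

/-- The members of a nonempty set `T` can receive the shortest strings of an injective code, of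
lengths at most `log₂ |T|`. -/
lemma exists_injective_code {B : Type*} [Fintype B] {T : Finset B} (hT : T.Nonempty) :
    ∃ f : B → List Bool, Function.Injective f ∧ ∀ x ∈ T, 2 ^ (f x).length ≤ T.card := by
  classical
  set L := Nat.log 2 T.card with hL
  have hlt : T.card < 2 ^ (L + 1) := Nat.lt_pow_succ_log_self one_lt_two _
  have hle : 2 ^ L ≤ T.card := Nat.pow_log_le_self 2 hT.card_pos.ne'
  have hcard : Fintype.card T ≤ Fintype.card (shortStrings L) := by
    rw [Fintype.card_coe, Fintype.card_coe]
    have := card_shortStrings_add_one L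
    omega
  obtain ⟨g⟩ := Function.Embedding.nonempty_of_card_le hcard
  have hg : ∀ x, ((g x : List Bool)).length ≤ L := fun x => mem_shortStrings.1 (g x).2
  -- Outside `T` the strings are told apart by their lengths, all of which exceed `L`.
  refine ⟨fun x => if h : x ∈ T then (g ⟨x, h⟩ : List Bool)
    else List.replicate (L + 1 + Fintype.equivFin B x) false, fun x y hxy => ?_, fun x hx => ?_⟩
  · by_cases hx : x ∈ T <;> by_cases hy : y ∈ T <;> simp only [hx, hy, dif_pos] at hxy
    · exact congrArg Subtype.val (g.injective (Subtype.ext hxy))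
    · have h := hg ⟨x, hx⟩
      rw [hxy] at h
      simp only [reduceDIte, List.length_replicate] at h
      omega
    · have h := hg ⟨y, hy⟩
      rw [← hxy] at h
      simp only [reduceDIte, List.length_replicate] at h
      omega
    · have h := congrArg List.length hxy
      simp only [reduceDIte, List.length_replicate] at h
      exact (Fintype.equivFin B).injective (Fin.ext (by omega))
  · simp only [hx, dif_pos]
    exact (Nat.pow_le_pow_right two_pos (hg _)).trans hle

/-- An injective code has at most `2 · 2 ^ t` codewords of length at most `t`. -/
lemma card_length_le_of_injective {B : Type*} {f : B → List Bool} (hf : Function.Injective f)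
    {T : Finset B} {t : ℝ} (ht : 0 ≤ t) (hT : ∀ x ∈ T, ((f x).length : ℝ) ≤ t) :
    (T.card : ℝ) ≤ 2 * 2 ^ t := by
  have h1 : T.card ≤ (shortStrings ⌊t⌋₊).card :=
    Finset.card_le_card_of_injOn f (fun x hx => mem_shortStrings.2 (Nat.le_floor (hT x hx)))
      hf.injOn
  have h2 := card_shortStrings_add_one ⌊t⌋₊
  calc (T.card : ℝ) ≤ ((2 ^ (⌊t⌋₊ + 1) : ℕ) : ℝ) := by exact_mod_cast (by omega)
    _ = 2 * (2 : ℝ) ^ (⌊t⌋₊ : ℝ) := by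
      rw [Real.rpow_natCast]
      push_cast
      ring
    _ ≤ _ := mul_le_mul_of_nonneg_left
      (Real.rpow_le_rpow_of_exponent_le one_le_two (Nat.floor_le ht)) zero_le_two

/-! ### The best tradeoff and the Bhattacharyya sum -/

section Tradeoff

variable {Ω A : Type*} [MeasurableSpace Ω] [Fintype A] [MeasurableSpace A]
  [MeasurableSingletonClass A] {ℙ : Measure Ω} [IsProbabilityMeasure ℙ] {X : ℕ → Ω → A}

lemma measureReal_block (hX : ∀ n, Measurable (X n)) (n : ℕ) (p : (Fin n → A) → Prop)
    [DecidablePred p] :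
    ℙ.real {ω | p (block X n ω)} = ∑ x with p x, marginal ℙ X n x := by
  simp only [marginal]
  rw [← measureReal_biUnion_finset]
  · congr 1
    ext ω
    simp
  · intro x _ y _ hxy
    refine Set.disjoint_left.2 fun ω h1 h2 => hxy ?_
    exact (Eq.symm h1).trans h2
  · exact fun x _ => measurableSet_block_eq hX n x

lemma sum_marginal (hX : ∀ n, Measurable (X n)) (n : ℕ) : ∑ x, marginal ℙ X n x = 1 := by
  have h := measureReal_block (ℙ := ℙ) hX n fun _ => True
  simpa using h.symm

lemma sum_marginal_le_one (hX : ∀ n, Measurable (X n)) (n : ℕ) (T : Finset (Fin n → A)) :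
    ∑ x ∈ T, marginal ℙ X n x ≤ 1 := by
  rw [← sum_marginal (ℙ := ℙ) hX n]
  exact Finset.sum_le_sum_of_subset_of_nonneg (Finset.subset_univ T)
    fun x _ _ => marginal_nonneg ℙ X n x

/-- Achievability: give the short codewords to the strings that are at least as likely under the
source as under the uniform law, and use `min p q ≤ √(p q)`. -/
lemma bestTradeoff_le_bhattacharyya [Nonempty A] (hX : ∀ n, Measurable (X n)) {n : ℕ}
    (hn : 1 ≤ n) : bestTradeoff ℙ X n ≤ bhattacharyya ℙ X n := by
  classical
  have hm : (0 : ℝ) < (Fintype.card A : ℝ) ^ n := pow_pos (by exact_mod_cast Fintype.card_pos) n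
  have hn0 : (n : ℝ) ≠ 0 := by positivity
  set T : Finset (Fin n → A) := {x | uniformMarginal A n x ≤ marginal ℙ X n x} with hT
  have hcardle : (T.card : ℝ) ≤ (Fintype.card A : ℝ) ^ n := by
    have := Finset.card_le_univ T
    rw [Fintype.card_fun, Fintype.card_fin] at this
    exact_mod_cast this
  have hTne : T.Nonempty := by
    obtain ⟨x, -, hx⟩ := Finset.exists_le_of_sum_le (s := (Finset.univ : Finset (Fin n → A)))
      (f := uniformMarginal A n) (g := marginal ℙ X n) Finset.univ_nonempty (by
        rw [sum_marginal hX, sum_uniformMarginal_eq, Finset.card_univ, Fintype.card_fun,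
          Fintype.card_fin, Nat.cast_pow, div_self hm.ne'])
    exact ⟨x, by simpa [hT] using hx⟩
  have hT1 : (1 : ℝ) ≤ T.card := by exact_mod_cast hTne.card_pos
  have hU : (T.card : ℝ) / (Fintype.card A : ℝ) ^ n ≤ bhattacharyya ℙ X n := by
    rw [← sum_uniformMarginal_eq]
    refine (Finset.sum_le_sum fun x hx => ?_).trans (sum_sqrt_le_bhattacharyya ℙ X n T)
    exact Real.le_sqrt_of_sq_le ((sq _).trans_le (mul_le_mul_of_nonneg_right
      (Finset.mem_filter.1 hx).2 (uniformMarginal_nonneg n x)))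
  have hP : ∑ x ∈ Tᶜ, marginal ℙ X n x ≤ bhattacharyya ℙ X n := by
    refine (Finset.sum_le_sum fun x hx => ?_).trans (sum_sqrt_le_bhattacharyya ℙ X n Tᶜ)
    have hx' : marginal ℙ X n x ≤ uniformMarginal A n x := by
      simp only [hT, Finset.mem_compl, Finset.mem_filter, Finset.mem_univ, true_and, not_le] at hx
      exact hx.le
    exact Real.le_sqrt_of_sq_le ((sq _).trans_le (mul_le_mul_of_nonneg_left hx'
      (marginal_nonneg ℙ X n x)))
  obtain ⟨f, hf, hlen⟩ := exists_injective_code hTne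
  refine le_of_forall_pos_le_add fun δ hδ => ?_
  -- The rate `log₂ |T| / n` may be zero, so it is approached from above.
  have ht : 1 < (T.card : ℝ) * (1 + δ) := by nlinarith
  have hR : 0 < Real.logb 2 (T.card * (1 + δ)) / n :=
    div_pos (Real.logb_pos one_lt_two ht) (by positivity)
  have hrate : (n : ℝ) * (Real.logb 2 (T.card * (1 + δ)) / n) = Real.logb 2 (T.card * (1 + δ)) :=
    mul_div_cancel₀ _ hn0
  have hbdd : BddBelow (Set.range fun c : Compressor A n × Set.Ioi (0 : ℝ) =>
      max (excessProb ℙ X n c.1 c.2)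
        ((2 : ℝ) ^ ((n : ℝ) * (c.2 : ℝ)) / (Fintype.card A : ℝ) ^ n)) :=
    ⟨0, by
      rintro _ ⟨c, rfl⟩
      exact le_max_of_le_left measureReal_nonneg⟩
  refine (ciInf_le hbdd (⟨f, hf⟩, ⟨_, hR⟩)).trans (max_le ?_ ?_)
  · rw [excessProb, measureReal_block hX n fun x => (n : ℝ) * _ < ((f x).length : ℝ)]
    refine le_trans (Finset.sum_le_sum_of_subset_of_nonneg (t := Tᶜ) (fun x hx => ?_)
      fun x _ _ => marginal_nonneg ℙ X n x) (hP.trans (le_add_of_nonneg_right hδ.le))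
    rw [Finset.mem_compl]
    intro hxT
    have h1 := (Finset.mem_filter.1 hx).2
    simp only at h1
    rw [hrate, Real.logb_lt_iff_lt_rpow one_lt_two (by linarith), Real.rpow_natCast] at h1
    have h2 : (2 : ℝ) ^ (f x).length ≤ T.card := by exact_mod_cast hlen x hxT
    nlinarith
  · simp only
    rw [hrate, Real.rpow_logb two_pos (by norm_num) (by linarith), mul_add, mul_one, add_div]
    refine add_le_add hU ?_
    rw [div_le_iff₀ hm, mul_comm]
    exact mul_le_mul_of_nonneg_left hcardle hδ.le

/-- Converse: split the Bhattacharyya sum over the strings with short and with long codewords and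
apply the Cauchy–Schwarz inequality to each part. -/
lemma sq_bhattacharyya_le_bestTradeoff [Nonempty A] (hX : ∀ n, Measurable (X n)) (n : ℕ) :
    bhattacharyya ℙ X n ^ 2 ≤ 16 * bestTradeoff ℙ X n := by
  classical
  have hm : (0 : ℝ) < (Fintype.card A : ℝ) ^ n := pow_pos (by exact_mod_cast Fintype.card_pos) n
  obtain ⟨f₀, hf₀, -⟩ := exists_injective_code
    (Finset.univ_nonempty (α := Fin n → A))
  have : Nonempty (Compressor A n × Set.Ioi (0 : ℝ)) := ⟨(⟨f₀, hf₀⟩, ⟨1, Set.mem_Ioi.2 one_pos⟩)⟩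
  rw [mul_comm, ← div_le_iff₀ (by norm_num)]
  refine le_ciInf ?_
  rintro ⟨⟨f, hf⟩, ⟨R, hR⟩⟩
  simp only
  set M := max (excessProb ℙ X n ⟨f, hf⟩ R) ((2 : ℝ) ^ ((n : ℝ) * R) / (Fintype.card A : ℝ) ^ n)
    with hM
  have hM0 : 0 ≤ M := le_max_of_le_left measureReal_nonneg
  have hR0 : 0 ≤ R := (Set.mem_Ioi.1 hR).le
  set T : Finset (Fin n → A) := {x | (n : ℝ) * R < ((f x).length : ℝ)} with hT
  have hPT : ∑ x ∈ T, marginal ℙ X n x ≤ M := by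
    rw [← measureReal_block hX n fun x => (n : ℝ) * R < ((f x).length : ℝ)]
    exact le_max_left _ _
  have hUT : ∑ x ∈ T, uniformMarginal A n x ≤ 1 := by
    rw [sum_uniformMarginal_eq, div_le_one hm]
    have := Finset.card_le_univ T
    rw [Fintype.card_fun, Fintype.card_fin] at this
    exact_mod_cast this
  have hUTc : ∑ x ∈ Tᶜ, uniformMarginal A n x ≤ 2 * M := by
    rw [sum_uniformMarginal_eq]
    have h := card_length_le_of_injective hf (T := Tᶜ) (t := n * R) (by positivity) fun x hx => by
      simpa [hT] using hx
    calc _ ≤ 2 * (2 : ℝ) ^ ((n : ℝ) * R) / (Fintype.card A : ℝ) ^ n :=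
          div_le_div_of_nonneg_right h hm.le
      _ = 2 * ((2 : ℝ) ^ ((n : ℝ) * R) / (Fintype.card A : ℝ) ^ n) := mul_div_assoc _ _ _
      _ ≤ _ := mul_le_mul_of_nonneg_left (le_max_right _ _) zero_le_two
  have hCS : ∀ S : Finset (Fin n → A), ∑ x ∈ S, √(marginal ℙ X n x * uniformMarginal A n x)
      ≤ √(∑ x ∈ S, marginal ℙ X n x) * √(∑ x ∈ S, uniformMarginal A n x) := fun S => by
    simp only [Real.sqrt_mul (marginal_nonneg ℙ X n _)]
    exact Real.sum_sqrt_mul_sqrt_le S (marginal_nonneg ℙ X n) (uniformMarginal_nonneg n)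
  have h1 : ∑ x ∈ T, √(marginal ℙ X n x * uniformMarginal A n x) ≤ √M * 1 :=
    (hCS T).trans (mul_le_mul (Real.sqrt_le_sqrt hPT) (Real.sqrt_le_one.2 hUT)
      (Real.sqrt_nonneg _) (Real.sqrt_nonneg _))
  have h2 : ∑ x ∈ Tᶜ, √(marginal ℙ X n x * uniformMarginal A n x) ≤ 1 * √(2 * M) :=
    (hCS Tᶜ).trans (mul_le_mul (Real.sqrt_le_one.2 (sum_marginal_le_one hX n _))
      (Real.sqrt_le_sqrt hUTc) (Real.sqrt_nonneg _) zero_le_one)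
  have h3 : √(2 * M) ≤ 2 * √M := by
    rw [Real.sqrt_mul zero_le_two]
    exact mul_le_mul_of_nonneg_right (Real.sqrt_le_iff.2 (by norm_num)) (Real.sqrt_nonneg _)
  have hle : bhattacharyya ℙ X n ≤ 4 * √M := by
    rw [bhattacharyya, ← Finset.sum_add_sum_compl T]
    linarith [Real.sqrt_nonneg M]
  have h0 : 0 ≤ bhattacharyya ℙ X n := Finset.sum_nonneg fun _ _ => Real.sqrt_nonneg _
  rw [div_le_iff₀ (by norm_num)]
  calc bhattacharyya ℙ X n ^ 2 ≤ (4 * √M) ^ 2 := pow_le_pow_left₀ h0 hle 2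
    _ = M * 16 := by
      rw [mul_pow, Real.sq_sqrt hM0]
      ring

end Tradeoff

/-! ### Rate and sample complexity -/

section Main

variable {Ω A : Type*} [MeasurableSpace Ω] [Fintype A]

lemma sampleComplexity_eq_of_nonempty {ℙ : Measure Ω} {X : ℕ → Ω → A} {ε : ℝ}
    (h : {n : ℕ | 1 ≤ n ∧ bestTradeoff ℙ X n ≤ ε}.Nonempty) :
    sampleComplexity ℙ X ε = ((sInf {n : ℕ | 1 ≤ n ∧ bestTradeoff ℙ X n ≤ ε} : ℕ) : ℕ∞) := by
  rw [sampleComplexity, sInf_image, ENat.natCast_sInf h]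

variable [Nonempty A] {μ : A → ℝ} {P : Matrix A A ℝ} {lam : ℝ} {v : A → ℝ}

lemma IsUnitPerronPair.infCoeff_pos (hμ : μ ∈ stdSimplex ℝ A)
    (h : IsUnitPerronPair (sqrtMatrix P) lam v) :
    0 < (∑ a, √(μ a) * v a) / (√(Fintype.card A : ℝ) * ⨅ a, v a) := by
  obtain ⟨i, hi⟩ := exists_eq_ciInf_of_finite (f := v)
  exact div_pos (sum_sqrt_mul_pos hμ h.eigenvector_pos)
    (mul_pos (Real.sqrt_pos.2 (by exact_mod_cast Fintype.card_pos)) (hi ▸ h.eigenvector_pos i))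

lemma IsUnitPerronPair.supCoeff_pos (hμ : μ ∈ stdSimplex ℝ A)
    (h : IsUnitPerronPair (sqrtMatrix P) lam v) :
    0 < (∑ a, √(μ a) * v a) / (√(Fintype.card A : ℝ) * ⨆ a, v a) := by
  obtain ⟨i, hi⟩ := exists_eq_ciSup_of_finite (f := v)
  exact div_pos (sum_sqrt_mul_pos hμ h.eigenvector_pos)
    (mul_pos (Real.sqrt_pos.2 (by exact_mod_cast Fintype.card_pos)) (hi ▸ h.eigenvector_pos i))

variable [MeasurableSpace A] [MeasurableSingletonClass A] {ℙ : Measure Ω}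
  [IsProbabilityMeasure ℙ] {X : ℕ → Ω → A}

lemma IsUnitPerronPair.hasRenyiRate (hμ : μ ∈ stdSimplex ℝ A) (hX : IsMarkovSource ℙ X μ P)
    (h : IsUnitPerronPair (sqrtMatrix P) lam v) :
    HasRenyiRate (marginal ℙ X) (uniformMarginal A) (-2 * Real.logb 2 lam) := by
  have hlim := (tendsto_logb_div_of_geometric (h.supCoeff_pos hμ) (h.infCoeff_pos hμ)
    h.eigenvalue_pos (le_bhattacharyya hX h) (bhattacharyya_le hX h)).const_mul (-2)
  refine hlim.congr fun n => ?_
  rw [renyiHalf, bhattacharyya]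
  ring

/-- The converse part: a blocklength `k + 1` that works for `ε` has
`c λᵏ ≤ ∑ √(P U) ≤ 4 √ε`. -/
lemma IsUnitPerronPair.le_of_bestTradeoff_le (hμ : μ ∈ stdSimplex ℝ A)
    (hX : IsMarkovSource ℙ X μ P) (h : IsUnitPerronPair (sqrtMatrix P) lam v) (hlam : lam < 1)
    {ε : ℝ} (hε : 0 < ε) {k : ℕ} (hk : bestTradeoff ℙ X (k + 1) ≤ ε) :
    (Real.logb 2 (1 / ε)
      + 2 * Real.logb 2 ((∑ a, √(μ a) * v a) / (√(Fintype.card A : ℝ) * ⨆ a, v a)) - 4)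
      / (-2 * Real.logb 2 lam) ≤ k := by
  have hc := h.supCoeff_pos hμ
  have hlow := le_bhattacharyya hX h k
  set c := (∑ a, √(μ a) * v a) / (√(Fintype.card A : ℝ) * ⨆ a, v a)
  have hpow := pow_pos h.eigenvalue_pos k
  have hsq : (c * lam ^ k) ^ 2 ≤ 2 ^ 4 * ε := by
    have h1 := pow_le_pow_left₀ (mul_pos hc hpow).le hlow 2
    have h2 := sq_bhattacharyya_le_bestTradeoff (ℙ := ℙ) hX.measurable (k + 1)
    linarith
  have hlog := Real.logb_le_logb_of_le one_lt_two (pow_pos (mul_pos hc hpow) 2) hsq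
  rw [Real.logb_pow, Real.logb_mul hc.ne' hpow.ne', Real.logb_pow,
    Real.logb_mul (by norm_num) hε.ne', Real.logb_pow, Real.logb_self_eq_one one_lt_two] at hlog
  have hneg : Real.logb 2 lam < 0 := Real.logb_neg one_lt_two h.eigenvalue_pos hlam
  rw [div_le_iff₀ (by linarith), one_div, Real.logb_inv]
  push_cast at hlog
  linarith

/-- The achievability part: a blocklength `k + 1` with `c λᵏ ≤ ε` works for `ε`. -/
lemma IsUnitPerronPair.bestTradeoff_le (hμ : μ ∈ stdSimplex ℝ A)
    (hX : IsMarkovSource ℙ X μ P) (h : IsUnitPerronPair (sqrtMatrix P) lam v) (hlam : lam < 1)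
    {ε : ℝ} (hε : 0 < ε) {k : ℕ}
    (hk : (2 * Real.logb 2 (1 / ε)
      + 2 * Real.logb 2 ((∑ a, √(μ a) * v a) / (√(Fintype.card A : ℝ) * ⨅ a, v a)))
      / (-2 * Real.logb 2 lam) ≤ k) :
    bestTradeoff ℙ X (k + 1) ≤ ε := by
  have hc := h.infCoeff_pos hμ
  have hup := bhattacharyya_le hX h k
  set c := (∑ a, √(μ a) * v a) / (√(Fintype.card A : ℝ) * ⨅ a, v a)
  have hpow := pow_pos h.eigenvalue_pos k
  have hneg : Real.logb 2 lam < 0 := Real.logb_neg one_lt_two h.eigenvalue_pos hlam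
  rw [div_le_iff₀ (by linarith), one_div, Real.logb_inv] at hk
  refine ((bestTradeoff_le_bhattacharyya hX.measurable (Nat.le_add_left 1 k)).trans hup).trans ?_
  rw [← Real.logb_le_logb one_lt_two (mul_pos hc hpow) hε, Real.logb_mul hc.ne' hpow.ne',
    Real.logb_pow]
  linarith

end Main

end

theorem theorem5 {A : Type*} [Fintype A] [DecidableEq A] [MeasurableSpace A]
    [MeasurableSingletonClass A] {Ω : Type*} [MeasurableSpace Ω]
    (ℙ : Measure Ω) [IsProbabilityMeasure ℙ] (X : ℕ → Ω → A)
    (μ : A → ℝ) (P : Matrix A A ℝ)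
    (hμ : μ ∈ stdSimplex ℝ A) (hP : P ∈ Matrix.rowStochastic ℝ A)
    (hirr : P.IsIrreducible) (hX : IsMarkovSource ℙ X μ P)
    (hne : ∃ i j, P i j ≠ 1 / (Fintype.card A : ℝ)) :
    ∃ D : ℝ, HasRenyiRate (marginal ℙ X) (uniformMarginal A) D ∧ 0 < D ∧
      (∃ (lam : ℝ) (v : A → ℝ), IsUnitPerronPair (sqrtMatrix P) lam v) ∧
      ∀ (lam : ℝ) (v : A → ℝ), IsUnitPerronPair (sqrtMatrix P) lam v →
        D = -2 * Real.logb 2 lam ∧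
        ∀ ε : ℝ, 0 < ε → ε < 1 →
          ∃ N : ℕ, sampleComplexity ℙ X ε = (N : ℕ∞) ∧
            (Real.logb 2 (1 / ε)
                + 2 * Real.logb 2 ((∑ a, √(μ a) * v a) / (√(Fintype.card A : ℝ) * ⨆ a, v a))
                - 4) / D + 1 ≤ (N : ℝ) ∧
            (N : ℝ) ≤ max 1
              ((2 * Real.logb 2 (1 / ε)
                + 2 * Real.logb 2 ((∑ a, √(μ a) * v a) / (√(Fintype.card A : ℝ) * ⨅ a, v a)))
                / D + 2) := by
  have : Nonempty A := hne.nonempty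
  have hrow : ∀ i, ∃ j, 0 < sqrtMatrix P i j := fun i => by
    obtain ⟨j, -, hj⟩ : ∃ j ∈ Finset.univ, 0 < P i j :=
      Finset.exists_lt_of_sum_lt (f := fun _ => (0 : ℝ))
        (by simp [Matrix.sum_row_of_mem_rowStochastic hP])
    exact ⟨j, sqrtMatrix_pos hj⟩
  obtain ⟨lam₀, v₀, h₀⟩ := hirr.sqrtMatrix.exists_isUnitPerronPair hrow
  have hrate₀ := h₀.hasRenyiRate hμ hX
  have hneg₀ := Real.logb_neg one_lt_two h₀.eigenvalue_pos (h₀.lt_one hP hne)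
  refine ⟨-2 * Real.logb 2 lam₀, hrate₀, by linarith, ⟨lam₀, v₀, h₀⟩, fun lam v h => ?_⟩
  have hD : -2 * Real.logb 2 lam₀ = -2 * Real.logb 2 lam :=
    tendsto_nhds_unique hrate₀ (h.hasRenyiRate hμ hX)
  refine ⟨hD, fun ε hε _ => ?_⟩
  rw [hD]
  have hlam := h.lt_one hP hne
  set y := (2 * Real.logb 2 (1 / ε)
    + 2 * Real.logb 2 ((∑ a, √(μ a) * v a) / (√(Fintype.card A : ℝ) * ⨅ a, v a)))
    / (-2 * Real.logb 2 lam) with hy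
  have hmem : ⌈y⌉₊ + 1 ∈ {n : ℕ | 1 ≤ n ∧ bestTradeoff ℙ X n ≤ ε} :=
    ⟨Nat.le_add_left 1 _, h.bestTradeoff_le hμ hX hlam hε (Nat.le_ceil y)⟩
  refine ⟨_, sampleComplexity_eq_of_nonempty ⟨_, hmem⟩, ?_, ?_⟩
  · obtain ⟨hN, hbest⟩ := Nat.sInf_mem ⟨_, hmem⟩
    obtain ⟨k, hk⟩ := Nat.exists_eq_add_of_le' hN
    rw [hk] at hbest ⊢
    rw [Nat.cast_add_one]
    exact add_le_add_left (h.le_of_bestTradeoff_le hμ hX hlam hε hbest) 1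
  · refine (Nat.cast_le.2 (Nat.sInf_le hmem)).trans ?_
    rw [Nat.cast_add_one]
    rcases le_or_gt y 0 with hy0 | hy0
    · rw [Nat.ceil_eq_zero.2 hy0]
      exact le_max_of_le_left (by norm_num)
    · exact le_max_of_le_right (by linarith [Nat.ceil_lt_add_one hy0.le])
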